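/- Let $k\ge 1$ and $1\le i\le k$ be integers. For every nonnegative integer $n$, the number of partitions of $n$ into parts not congruent to $2 \pmod 4$ and not congruent to $0$ or $2k\pm(2i-1) \pmod{4k}$ is equal to the number of partitions $(b_1\ge b_2\ge\dots\ge b_s)$ of $n$ satisfying the following conditions: (1) no odd part is repeated; (2) for every $p$ with $1\le p$ and $p+k-1\le s$, one has $b_p-b_{p+k-1}\ge 2$ if $b_p$ is odd and $b_p-b_{p+k-1}>2$ if $b_p$ is even; (3) at most $k-i$ of the parts (counted with multiplicity) are equal to $1$ or $2$. -/

import Mathlib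

/-- The partitions of `n` all of whose parts are not congruent to `2` modulo `4` and not congruent to
`0`, `2k + (2i - 1)` or `2k - (2i - 1)` modulo `4k`. The congruences are between integers. -/
def IsGGAProductPartition (k i : ℕ) {n : ℕ} (P : n.Partition) : Prop :=
  ∀ m ∈ P.parts,
    ¬ ((m : ℤ) ≡ 2 [ZMOD 4]) ∧
    ¬ ((m : ℤ) ≡ 0 [ZMOD 4 * (k : ℤ)]) ∧
    ¬ ((m : ℤ) ≡ 2 * (k : ℤ) + (2 * (i : ℤ) - 1) [ZMOD 4 * (k : ℤ)]) ∧
    ¬ ((m : ℤ) ≡ 2 * (k : ℤ) - (2 * (i : ℤ) - 1) [ZMOD 4 * (k : ℤ)])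

/-- The parts `b₁ ≥ b₂ ≥ … ≥ bₛ` of a partition, listed in weakly decreasing order;
the part `bₚ` is the entry with (zero-based) index `p - 1`. -/
def partsList {n : ℕ} (P : n.Partition) : List ℕ :=
  P.parts.sort (· ≥ ·)

/-- The partitions `(b₁ ≥ … ≥ bₛ)` of `n` in which no odd part is repeated,
`bₚ - bₚ₊ₖ₋₁ ≥ 2` if `bₚ` is odd and `bₚ - bₚ₊ₖ₋₁ > 2` if `bₚ` is even (for all `p` such that both
parts exist), and at most `k - i` parts are equal to `1` or `2`. -/
def IsGGASumPartition (k i : ℕ) {n : ℕ} (P : n.Partition) : Prop :=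
  (∀ m : ℕ, Odd m → P.parts.count m ≤ 1) ∧
  (∀ (p : ℕ) (_ : p + (k - 1) < (partsList P).length),
    (Odd (partsList P)[p] →
      ((partsList P)[p] : ℤ) - ((partsList P)[p + (k - 1)] : ℤ) ≥ 2) ∧
    (Even (partsList P)[p] →
      ((partsList P)[p] : ℤ) - ((partsList P)[p + (k - 1)] : ℤ) > 2)) ∧
  (P.parts.count 1 + P.parts.count 2 ≤ k - i)

open Finset

/-! Coefficients are compared modulo X^(n+1), where q = X is nilpotent: infinite products and series
become finite and 1 - q^s is a unit for s ≥ 1.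

Sum side: conditions (2) and (3) amount to saying that every window {2j, 2j+1, 2j+2} holds at most
k-1 parts and that at most k-i parts are 1 or 2 (`isGGASumPartition_iff`). Sorting the multisets
with parts > 2m by how often 2m+1 and 2m+2 occur gives a recurrence (`windowSet_zero`,
`multisetGF_windowSet_succ`). Andrews' functions J_{k,i}(-1/q; x; q²) at x = q^(2m) satisfy the same
recurrence (`andrewsJ_zero`, `andrewsJ_succ`) with the same value for large m, so up to the factor
(q²;q²)_∞ they are the generating functions (`map_multisetGF_windowSet`).

Product side: at x = 1, J is (-q;q²)_∞ times a theta series (`andrewsJ_at_zero`), which the Jacobi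
triple product (`sum_thetaTerm`) turns into the factors with exponents 0, ±(2k-2i+1) mod 4k. Since
(-q;q²)_∞ / (q²;q²)_∞ generates the partitions without parts 2 mod 4, and those three classes avoid
2 mod 4, the quotient is the required product. -/

/-- The product `∏ (1 - c p ^ j)` over `s ≤ j < s + N`; when `p ^ N = 0` this is the
infinite `q`-Pochhammer symbol `(c p ^ s; p)_∞`. -/
def qTail {R : Type*} [CommRing R] (N : ℕ) (c p : R) (s : ℕ) : R :=
  ∏ j ∈ range N, (1 - c * p ^ (s + j))

/-! ### Truncated q-Pochhammer symbols at a nilpotent base -/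

section qTail

variable {R : Type*} [CommRing R] {N : ℕ} {c p : R}

theorem qTail_eq_mul_succ (hp : p ^ N = 0) (s : ℕ) :
    qTail N c p s = (1 - c * p ^ s) * qTail N c p (s + 1) := by
  have h1 := prod_range_succ (fun j => 1 - c * p ^ (s + j)) N
  have h2 := prod_range_succ' (fun j => 1 - c * p ^ (s + j)) N
  have h3 : p ^ (s + N) = 0 := by rw [pow_add, hp, mul_zero]
  rw [h1, h3] at h2
  simp only [mul_zero, sub_zero, mul_one, add_zero] at h2
  rw [qTail, qTail, h2, mul_comm]
  congr 1
  exact prod_congr rfl fun j _ => by rw [add_assoc s 1 j, add_comm 1 j]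

theorem qTail_eq_one (hp : p ^ N = 0) {s : ℕ} (hs : N ≤ s) : qTail N c p s = 1 :=
  prod_eq_one fun j _ => by rw [pow_eq_zero_of_le (by omega) hp]; simp

theorem prod_range_mul_qTail (hp : p ^ N = 0) (n s : ℕ) :
    (∏ j ∈ range n, (1 - c * p ^ (s + j))) * qTail N c p (s + n) = qTail N c p s := by
  induction n with
  | zero => simp
  | succ n ih => rw [prod_range_succ, mul_assoc, ← add_assoc, ← qTail_eq_mul_succ hp, ih]

theorem isUnit_one_sub_pow (hp : p ^ N = 0) {s : ℕ} (hs : s ≠ 0) : IsUnit (1 - p ^ s) := by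
  have h : IsNilpotent (p ^ s) := ⟨N, by rw [← pow_mul, mul_comm, pow_mul, hp, zero_pow hs]⟩
  exact h.isUnit_one_sub

end qTail

/-! ### Jacobi triple product, through its finite form -/

section TripleProduct

variable {R : Type*} [CommRing R] {N : ℕ} {a b : R}

/-- The coefficient of the `n`-th term in the finite form of the triple product. -/
def tripleCoeff (N : ℕ) (p : R) (m n : ℕ) : R :=
  if n ≤ m then qTail N 1 p (m - n + 1) * qTail N 1 p (m + n + 2) else 0

/-- The sum of the terms of the theta series with indices `n` and `-n-1`. -/
def thetaTerm (a b : R) (n : ℕ) : R :=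
  a ^ n * (a * b) ^ (n.choose 2) * (1 - b ^ (2 * n + 1))

/-- `tripleCoeff N p m n` plays the role of the Gaussian binomial [2m+1, m-n] times (p;p)_∞² /
(p;p)_{2m+1}. This is the q-Pascal rule applied twice, from row 2m+1 to row 2m+3, cleared of
denominators. -/
theorem tripleCoeff_succ_mul {p : R} (hp : p ^ N = 0) (m n : ℕ) (hn : n + 1 ≤ m + 1) :
    (1 - p ^ (2 * m + 2)) * (1 - p ^ (2 * m + 3)) * tripleCoeff N p (m + 1) (n + 1) =
      (1 + p ^ (2 * m + 2)) * tripleCoeff N p m (n + 1) +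
        p ^ (m + n + 3) * tripleCoeff N p m (n + 2) + p ^ (m - n) * tripleCoeff N p m n := by
  obtain ⟨d, rfl⟩ : ∃ d, m = n + d := ⟨m - n, by omega⟩
  -- The coefficients of index n+1 and n+2 vanish for d < 1 and d < 2 respectively.
  rcases d with _ | _ | d
  · simp only [tripleCoeff, add_zero, le_refl, if_true, Nat.sub_self, zero_add,
      show ¬ (n + 1 ≤ n) by omega, show ¬ (n + 2 ≤ n) by omega, if_false, mul_zero, pow_zero,
      one_mul, show n + 1 + (n + 1) + 2 = n + n + 2 + 1 + 1 by ring]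
    rw [qTail_eq_mul_succ hp (n + n + 2), qTail_eq_mul_succ hp (n + n + 2 + 1)]
    ring
  · simp only [tripleCoeff, zero_add, le_refl, if_true, Nat.sub_self,
      show ¬ (n + 2 ≤ n + 1) by omega, if_false, mul_zero, show n ≤ n + 1 by omega,
      show n + 1 ≤ n + 1 + 1 by omega, show n + 1 - n = 1 by omega,
      show n + 1 + 1 - (n + 1) = 1 by omega, show n + 1 + 1 + (n + 1) + 2 = n + n + 3 + 1 + 1 by ring,
      show n + 1 + n + 2 = n + n + 3 by ring, show n + 1 + (n + 1) + 2 = n + n + 3 + 1 by ring]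
    rw [qTail_eq_mul_succ hp (n + n + 3), qTail_eq_mul_succ hp (n + n + 3 + 1),
      qTail_eq_mul_succ hp 1]
    ring
  · simp only [tripleCoeff, if_true, show n ≤ n + (d + 1 + 1) by omega,
      show n + 1 ≤ n + (d + 1 + 1) + 1 by omega, show n + 1 ≤ n + (d + 1 + 1) by omega,
      show n + 2 ≤ n + (d + 1 + 1) by omega,
      show n + (d + 1 + 1) + 1 - (n + 1) + 1 = d + 3 by omega,
      show n + (d + 1 + 1) - (n + 1) + 1 = d + 2 by omega,
      show n + (d + 1 + 1) - (n + 2) + 1 = d + 1 by omega,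
      show n + (d + 1 + 1) - n = d + 2 by omega,
      show n + (d + 1 + 1) + 1 + (n + 1) + 2 = 2 * n + d + 6 by ring,
      show n + (d + 1 + 1) + (n + 1) + 2 = 2 * n + d + 5 by ring,
      show n + (d + 1 + 1) + (n + 2) + 2 = 2 * n + d + 6 by ring,
      show n + (d + 1 + 1) + n + 2 = 2 * n + d + 4 by ring,
      show d + 2 + 1 = d + 3 by ring]
    rw [qTail_eq_mul_succ hp (2 * n + d + 4), qTail_eq_mul_succ hp (2 * n + d + 5),
      qTail_eq_mul_succ hp (d + 1), qTail_eq_mul_succ hp (d + 2)]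
    ring

/-- The same rule at n = -1, where the symmetry n ↔ -n-1 of the Gaussian binomial replaces index -1
by 0. -/
theorem tripleCoeff_succ_zero {p : R} (hp : p ^ N = 0) (m : ℕ) :
    (1 - p ^ (2 * m + 2)) * (1 - p ^ (2 * m + 3)) * tripleCoeff N p (m + 1) 0 =
      (1 + p ^ (2 * m + 2)) * tripleCoeff N p m 0 +
        p ^ (m + 2) * tripleCoeff N p m 1 + p ^ (m + 1) * tripleCoeff N p m 0 := by
  rcases m with _ | d
  · simp only [tripleCoeff, le_refl, if_true, Nat.sub_self, zero_add, Nat.zero_le, Nat.sub_zero,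
      show ¬ (1 ≤ 0) by omega, if_false, mul_zero, add_zero]
    rw [qTail_eq_mul_succ hp 1, qTail_eq_mul_succ hp (1 + 1)]
    ring
  · simp only [tripleCoeff, if_true, Nat.sub_zero, Nat.zero_le, show 1 ≤ d + 1 by omega, add_zero,
      Nat.add_sub_cancel]
    rw [qTail_eq_mul_succ hp (d + 1), qTail_eq_mul_succ hp (d + 1 + 1),
      qTail_eq_mul_succ hp (d + 1 + 2), show d + 1 + 2 + 1 = d + 1 + 1 + 2 by ring]
    ring

/-- The finite form of the theta series. -/
def tripleSum (N : ℕ) (a b : R) (m : ℕ) : R :=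
  ∑ n ∈ range (m + 1), (-1) ^ n * thetaTerm a b n * tripleCoeff N (a * b) m n

theorem thetaTerm_zero : thetaTerm a b 0 = 1 - b := by simp [thetaTerm]

/-- Boundary case of `mul_thetaTerm_succ`: the term of index -1 is minus the term of index 0. -/
theorem mul_thetaTerm_zero (m : ℕ) :
    (b * (a * b) ^ (m + 1) + a * (a * b) ^ m) * thetaTerm a b 0 =
      - (a * b) ^ (m + 1) * thetaTerm a b 0 + (a * b) ^ m * thetaTerm a b 1 := by
  simp only [thetaTerm]; simp; ring

theorem mul_thetaTerm_succ {m n : ℕ} (h : n + 1 ≤ m) :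
    (b * (a * b) ^ (m + 1) + a * (a * b) ^ m) * thetaTerm a b (n + 1) =
      (a * b) ^ (m + n + 2) * thetaTerm a b n + (a * b) ^ (m - (n + 1)) * thetaTerm a b (n + 2) := by
  obtain ⟨d, rfl⟩ : ∃ d, m = n + 1 + d := ⟨m - (n + 1), by omega⟩
  have h1 : (n + 1).choose 2 = n.choose 2 + n := by
    rw [Nat.choose_succ_succ' n 1]; simp [add_comm]
  have h2 : (n + 2).choose 2 = n.choose 2 + n + (n + 1) := by
    rw [Nat.choose_succ_succ' (n + 1) 1, h1]; simp; ring
  simp only [thetaTerm, h1, h2, show n + 1 + d - (n + 1) = d by omega]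
  ring

/-- Since ab = p, the two right-hand factors multiply to 1 + p^(2m+2) - (b p^(m+1) + a p^m). The
bracket shifts theta terms to their neighbours; moving the shifts onto the coefficients yields the
double q-Pascal rule. -/
theorem tripleSum_succ (hp : (a * b) ^ N = 0) (m : ℕ) :
    (1 - (a * b) ^ (2 * m + 2)) * (1 - (a * b) ^ (2 * m + 3)) * tripleSum N a b (m + 1) =
      (1 - b * (a * b) ^ (m + 1)) * (1 - a * (a * b) ^ m) * tripleSum N a b m := by
  set p := a * b with hpdef
  have hR : (1 - b * p ^ (m + 1)) * (1 - a * p ^ m) * tripleSum N a b m =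
      (1 + p ^ (2 * m + 2)) * tripleSum N a b m -
        ∑ n ∈ range (m + 1), (-1) ^ n * ((b * p ^ (m + 1) + a * p ^ m) * thetaTerm a b n) *
          tripleCoeff N p m n := by
    rw [show (1 - b * p ^ (m + 1)) * (1 - a * p ^ m) =
      (1 + p ^ (2 * m + 2)) - (b * p ^ (m + 1) + a * p ^ m) by
        rw [show p ^ (2 * m + 2) = p * p ^ (2 * m + 1) by ring]; nth_rw 4 [hpdef]; ring, sub_mul]
    congr 1
    rw [tripleSum, mul_sum]
    exact sum_congr rfl fun n _ => by ring
  have hS : tripleSum N a b m = (-1) ^ 0 * thetaTerm a b 0 * tripleCoeff N p m 0 +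
      ∑ n ∈ range (m + 1), (-1) ^ (n + 1) * thetaTerm a b (n + 1) * tripleCoeff N p m (n + 1) := by
    rw [tripleSum, sum_range_succ', sum_range_succ _ m, add_comm]
    simp [tripleCoeff, hpdef]
  have hA : ∑ n ∈ range (m + 1), (-1) ^ n * ((b * p ^ (m + 1) + a * p ^ m) * thetaTerm a b n) *
        tripleCoeff N p m n =
      - (p ^ (m + 1) * tripleCoeff N p m 0 + p ^ (m + 2) * tripleCoeff N p m 1) * thetaTerm a b 0 -
      ∑ n ∈ range (m + 1), (-1) ^ (n + 1) * thetaTerm a b (n + 1) *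
        (p ^ (m + n + 3) * tripleCoeff N p m (n + 2) + p ^ (m - n) * tripleCoeff N p m n) := by
    -- Reindexing by one; the surplus top terms vanish because `tripleCoeff` is zero beyond m.
    have e1 : ∑ n ∈ range (m + 1), (-1) ^ (n + 1) * thetaTerm a b (n + 1) *
        (p ^ (m + n + 3) * tripleCoeff N p m (n + 2)) + p ^ (m + 2) * tripleCoeff N p m 1 * thetaTerm a b 0
        = ∑ n ∈ range m, (-1) ^ n * thetaTerm a b n * (p ^ (m + n + 2) * tripleCoeff N p m (n + 1)) := by
      have := sum_range_succ' (fun n => (-1) ^ n * thetaTerm a b n *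
        (p ^ (m + n + 2) * tripleCoeff N p m (n + 1))) (m + 1)
      rw [sum_range_succ, sum_range_succ] at this
      simp only [tripleCoeff, show ¬ (m + 1 ≤ m) by omega, show ¬ (m + 1 + 1 ≤ m) by omega, if_false,
        mul_zero, add_zero] at this
      simp only [tripleCoeff]
      rw [this]
      simp only [pow_zero, zero_add]
      congr 1
      ring
    have e2 := sum_range_succ' (fun n => (-1) ^ n * ((b * p ^ (m + 1) + a * p ^ m) * thetaTerm a b n) *
          tripleCoeff N p m n) m
    rw [e2, mul_thetaTerm_zero]
    have e3 : ∑ n ∈ range m, (-1) ^ (n + 1) * ((b * p ^ (m + 1) + a * p ^ m) * thetaTerm a b (n + 1)) *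
          tripleCoeff N p m (n + 1) =
        - ∑ n ∈ range m, (-1) ^ n * thetaTerm a b n * (p ^ (m + n + 2) * tripleCoeff N p m (n + 1)) -
        ∑ n ∈ range m, (-1) ^ (n + 2) * thetaTerm a b (n + 2) *
          (p ^ (m - (n + 1)) * tripleCoeff N p m (n + 1)) := by
      rw [← sum_neg_distrib, ← sum_sub_distrib]
      refine sum_congr rfl fun n hn => ?_
      rw [mul_thetaTerm_succ (mem_range.1 hn)]
      ring
    have e4 := sum_range_succ' (fun n => (-1) ^ (n + 1) * thetaTerm a b (n + 1) *
          (p ^ (m - n) * tripleCoeff N p m n)) m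
    simp only [mul_add (_ * _), sum_add_distrib]
    rw [e3, ← e1, e4]
    simp only [Nat.sub_zero, zero_add, pow_zero, add_assoc, one_add_one_eq_two]
    ring
  rw [hR, hA, hS, tripleSum, sum_range_succ', mul_add, mul_sum, mul_add, mul_sum]
  have h0 := tripleCoeff_succ_zero hp m
  have : ∀ n ∈ range (m + 1), (1 - p ^ (2 * m + 2)) * (1 - p ^ (2 * m + 3)) *
      ((-1) ^ (n + 1) * thetaTerm a b (n + 1) * tripleCoeff N p (m + 1) (n + 1)) =
      (1 + p ^ (2 * m + 2)) * ((-1) ^ (n + 1) * thetaTerm a b (n + 1) * tripleCoeff N p m (n + 1)) +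
      (-1) ^ (n + 1) * thetaTerm a b (n + 1) *
        (p ^ (m + n + 3) * tripleCoeff N p m (n + 2) + p ^ (m - n) * tripleCoeff N p m n) := by
    intro n hn
    have := tripleCoeff_succ_mul hp m n (by simpa using mem_range.1 hn)
    linear_combination ((-1) ^ (n + 1) * thetaTerm a b (n + 1)) * this
  rw [sum_congr rfl this, sum_add_distrib]
  linear_combination thetaTerm a b 0 * h0

theorem tripleSum_mul_prod (hp : (a * b) ^ N = 0) (m : ℕ) :
    (∏ j ∈ range (2 * m), (1 - 1 * (a * b) ^ (2 + j))) * tripleSum N a b m =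
      (∏ j ∈ range (m + 1), (1 - b * (a * b) ^ (0 + j))) *
        (∏ j ∈ range m, (1 - a * (a * b) ^ (0 + j))) *
          (qTail N 1 (a * b) 1 * qTail N 1 (a * b) 2) := by
  induction m with
  | zero => simp [tripleSum, tripleCoeff, thetaTerm_zero, mul_assoc]
  | succ m ih =>
    rw [show 2 * (m + 1) = 2 * m + 1 + 1 by ring, prod_range_succ, prod_range_succ,
      prod_range_succ (fun j => 1 - b * (a * b) ^ (0 + j)) (m + 1),
      prod_range_succ (fun j => 1 - a * (a * b) ^ (0 + j)) m]
    have := tripleSum_succ hp m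
    rw [show 2 + (2 * m + 1) = 2 * m + 3 by ring, show 2 + 2 * m = 2 * m + 2 by ring]
    simp only [zero_add] at *
    linear_combination (∏ j ∈ range (2 * m), (1 - 1 * (a * b) ^ (2 + j))) * this +
      (1 - b * (a * b) ^ (m + 1)) * (1 - a * (a * b) ^ m) * ih

/-- The **Jacobi triple product** identity for nilpotent arguments. -/
theorem sum_thetaTerm (ha : a ^ N = 0) :
    ∑ n ∈ range N, (-1) ^ n * thetaTerm a b n =
      qTail N b (a * b) 0 * qTail N a (a * b) 0 * qTail N 1 (a * b) 1 := by
  have hp : (a * b) ^ N = 0 := by rw [mul_pow, ha, zero_mul]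
  have hu : IsUnit (qTail N 1 (a * b) 2) := by
    rw [qTail, IsUnit.prod_iff]
    exact fun j _ => by rw [one_mul]; exact isUnit_one_sub_pow hp (by omega)
  -- With m = 2N every finite product is already infinite, and the coefficients with n < N reduce to
  -- 1; the terms with n ≥ N die with a^n.
  have h := tripleSum_mul_prod hp (2 * N)
  have hz : ∀ {c : R} {m : ℕ}, N ≤ m → ∀ s,
      (∏ j ∈ range m, (1 - c * (a * b) ^ (s + j))) = qTail N c (a * b) s := by
    intro c m hm s
    rw [← prod_range_mul_qTail hp m s, qTail_eq_one hp (by omega), mul_one]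
  rw [hz (by omega), hz (by omega), hz (by omega)] at h
  have hs : tripleSum N a b (2 * N) = ∑ n ∈ range N, (-1) ^ n * thetaTerm a b n := by
    rw [tripleSum, ← sum_subset (range_subset_range.2 (by omega : N ≤ 2 * N + 1))]
    · refine sum_congr rfl fun n hn => ?_
      have := mem_range.1 hn
      rw [tripleCoeff, if_pos (by omega), qTail_eq_one hp (by omega), qTail_eq_one hp (by omega)]
      simp
    · intro n _ hn
      rw [thetaTerm, pow_eq_zero_of_le (by simpa using hn) ha]
      simp
  rw [hs] at h
  apply hu.mul_left_cancel
  rw [h]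
  ring

end TripleProduct

/-! ### Andrews' q-difference equations -/

section Andrews

variable {R : Type*} [CommRing R] {N : ℕ} {q : R}

/-- The product part of the `n`-th term of Andrews' series at `x = q ^ (2 m + 2)`. -/
def andrewsProd (N : ℕ) (q : R) (m n : ℕ) : R :=
  (∏ j ∈ range m, (1 - q ^ (2 * (n + 1 + j)))) * (∏ j ∈ range n, (1 + q ^ (2 * j + 1))) *
    qTail N (-q) (q ^ 2) (m + n + 1)

/-- Andrews' series `H_{k,i}(-1/q; x; q²)` at `x = q ^ (2 m + 2)` with `k = i + i'`, up to a
factor not depending on `m` and `i`. -/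
def andrewsH (N : ℕ) (q : R) (i i' m : ℕ) : R :=
  ∑ n ∈ range N, (-1) ^ n * q ^ (2 * (i + i') * (n * (n - 1)) + n) *
    (q ^ (2 * m + 2)) ^ ((i + i') * n) *
      ((q ^ (2 * n)) ^ i' * (1 - (q ^ (2 * m + 2)) ^ i * (q ^ (2 * n)) ^ (2 * i))) *
        andrewsProd N q m n

theorem andrewsProd_mul_one_sub (hq : q ^ N = 0) (m n : ℕ) :
    andrewsProd N q m n * (1 - q ^ (2 * m + 2) * q ^ (2 * n)) =
      andrewsProd N q (m + 1) n * (1 + q ^ (2 * m + 2) * q ^ (2 * n) * q) := by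
  have hp : (q ^ 2) ^ N = 0 := by rw [pow_right_comm, hq, zero_pow two_ne_zero]
  rw [andrewsProd, andrewsProd, prod_range_succ, qTail_eq_mul_succ hp,
    show m + 1 + n + 1 = m + n + 1 + 1 by ring]
  ring

theorem andrewsProd_succ_mul_one_sub (m n : ℕ) :
    andrewsProd N q m (n + 1) * (1 - q ^ 2 * q ^ (2 * n)) =
      andrewsProd N q (m + 1) n * (1 + q * q ^ (2 * n)) := by
  rw [andrewsProd, andrewsProd, prod_range_succ' _ m, prod_range_succ _ n,
    show m + (n + 1) + 1 = m + 1 + n + 1 by ring]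
  have : ∏ j ∈ range m, (1 - q ^ (2 * (n + 1 + (j + 1)))) =
      ∏ j ∈ range m, (1 - q ^ (2 * (n + 1 + 1 + j))) :=
    prod_congr rfl fun j _ => by rw [add_assoc (n + 1) 1 j, add_comm 1 j]
  rw [this]
  ring

/-- With Q = q^(2n) and x = q^(2m+2), the difference of the brackets splits as Q^d (1 - Q) + x^c
Q^(k+c) (1 - xQ). Each linear factor is absorbed by `andrewsProd`, raising m by one; the first part
also needs the shift n → n+1. -/
theorem andrewsH_succ_sub (hq : q ^ N = 0) (c d m : ℕ) :
    andrewsH N q (c + 1) d m - andrewsH N q c (d + 1) m =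
      (q ^ (2 * m + 2)) ^ c * (andrewsH N q (d + 1) c (m + 1) +
        q ^ (2 * m + 3) * andrewsH N q d (c + 1) (m + 1)) := by
  rcases Nat.eq_zero_or_pos N with rfl | hN
  · simp [andrewsH]
  set k := c + d + 1 with hk
  set f : ℕ → R := fun n => (-1) ^ n * q ^ (2 * k * (n * (n - 1)) + n) *
    (q ^ (2 * m + 2)) ^ (k * n) * ((q ^ (2 * n)) ^ d * (1 - q ^ (2 * n))) * andrewsProd N q m n
    with hf
  set g : ℕ → R := fun n => (-1) ^ n * q ^ (2 * k * (n * (n - 1)) + n) *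
    (q ^ (2 * m + 2)) ^ (k * n) * ((q ^ (2 * m + 2)) ^ c * (q ^ (2 * n)) ^ (k + c)) *
      (andrewsProd N q m n * (1 - q ^ (2 * m + 2) * q ^ (2 * n))) with hg
  have h1 : andrewsH N q (c + 1) d m - andrewsH N q c (d + 1) m =
      ∑ n ∈ range N, f n + ∑ n ∈ range N, g n := by
    rw [andrewsH, andrewsH, ← sum_sub_distrib, ← sum_add_distrib]
    refine sum_congr rfl fun n _ => ?_
    simp only [hf, hg, show c + 1 + d = k by omega, show c + (d + 1) = k by omega]
    rw [hk]
    ring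
  -- The shift is free: f 0 contains 1 - q^0, and f N contains q^N.
  have h2 : ∑ n ∈ range N, f n = ∑ n ∈ range N, f (n + 1) := by
    have e := sum_range_succ' f N
    rw [sum_range_succ] at e
    have e0 : f 0 = 0 := by simp [hf]
    have eN : f N = 0 := by simp only [hf]; rw [pow_add q, hq]; simp
    rwa [e0, eN, add_zero, add_zero] at e
  rw [h1, h2, andrewsH, andrewsH, mul_sum, ← sum_add_distrib, ← sum_add_distrib, mul_sum]
  refine sum_congr rfl fun n _ => ?_
  have a1 := andrewsProd_mul_one_sub hq m n
  have a2 := andrewsProd_succ_mul_one_sub (N := N) (q := q) m n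
  have hw : q ^ (2 * k * ((n + 1) * (n + 1 - 1)) + (n + 1)) =
      q ^ (2 * k * (n * (n - 1)) + n) * (q * (q ^ (2 * n)) ^ (2 * k)) := by
    rw [← pow_mul, ← pow_succ', ← pow_add]
    congr 1
    rcases n with _ | n
    · simp
    · simp only [Nat.add_sub_cancel]; ring
  have hF : f (n + 1) = - (-1) ^ n * (q ^ (2 * k * (n * (n - 1)) + n) *
      (q * (q ^ (2 * n)) ^ (2 * k))) * (q ^ (2 * m + 2)) ^ (k * (n + 1)) *
        (q ^ (2 * (n + 1))) ^ d * (andrewsProd N q (m + 1) n * (1 + q * q ^ (2 * n))) := by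
    rw [← a2, ← hw]
    simp only [hf]
    ring
  rw [hF]
  simp only [hg]
  rw [a1]
  simp only [show d + 1 + c = k by omega, show d + (c + 1) = k by omega]
  set w := q ^ (2 * k * (n * (n - 1)) + n)
  set B := andrewsProd N q (m + 1) n
  clear_value w B
  rw [hk]
  ring

/-- Andrews' series `J_{k,c+1}` at `x = q ^ (2 m)`, where `k = c + c' + 1`. -/
def andrewsJ (N : ℕ) (q : R) (c c' m : ℕ) : R :=
  andrewsH N q (c + 1) c' m + q ^ (2 * m + 1) * andrewsH N q c (c' + 1) m

theorem andrewsH_zero (i' m : ℕ) : andrewsH N q 0 i' m = 0 :=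
  sum_eq_zero fun n _ => by simp

theorem andrewsJ_zero (hq : q ^ N = 0) (d m : ℕ) :
    andrewsJ N q 0 d m = andrewsJ N q d 0 (m + 1) := by
  have := andrewsH_succ_sub hq 0 d m
  rw [andrewsH_zero, sub_zero] at this
  rw [andrewsJ, andrewsJ, this, andrewsH_zero]
  ring

theorem andrewsJ_succ (hq : q ^ N = 0) (c d m : ℕ) :
    andrewsJ N q (c + 1) d m = andrewsJ N q c (d + 1) m +
      q ^ ((2 * m + 2) * (c + 1)) * andrewsJ N q d (c + 1) (m + 1) +
        q ^ (2 * m + 1 + (2 * m + 2) * c) * andrewsJ N q (d + 1) c (m + 1) := by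
  have h1 := andrewsH_succ_sub hq (c + 1) d m
  have h2 := andrewsH_succ_sub hq c (d + 1) m
  simp only [andrewsJ]
  linear_combination h1 + q ^ (2 * m + 1) * h2

/-- Here x = 0, so only the term n = 0 survives; its value is the normalising factor omitted from
`andrewsH`. -/
theorem andrewsJ_eq_qTail (hq : q ^ N = 0) (c d m : ℕ) (hm : N ≤ m) :
    andrewsJ N q c d m = qTail N 1 (q ^ 2) 1 := by
  have hp : (q ^ 2) ^ N = 0 := by rw [pow_right_comm, hq, zero_pow two_ne_zero]
  have hy : q ^ (2 * m + 2) = 0 := pow_eq_zero_of_le (by omega) hq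
  have hy' : q ^ (2 * m + 1) = 0 := pow_eq_zero_of_le (by omega) hq
  rw [andrewsJ, hy', zero_mul, add_zero, andrewsH, hy]
  have hP : andrewsProd N q m 0 = qTail N 1 (q ^ 2) 1 := by
    rw [andrewsProd, qTail_eq_one hp (by omega), ← prod_range_mul_qTail hp m 1,
      qTail_eq_one hp (show N ≤ 1 + m by omega)]
    simp [pow_mul]
  rcases N with _ | N
  · have : Subsingleton R := subsingleton_of_zero_eq_one (by simpa using hq.symm)
    exact Subsingleton.elim _ _
  · rw [sum_range_succ', sum_eq_zero]
    · simp [hP]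
    · intro n _
      rw [zero_pow (by positivity)]
      simp

theorem andrewsJ_at_zero (hq : q ^ N = 0) (c d : ℕ) :
    andrewsJ N q c d 0 = qTail N (-q) (q ^ 2) 0 *
      ∑ n ∈ range N, (-1) ^ n * thetaTerm (q ^ (2 * c + 4 * d + 3)) (q ^ (2 * c + 1)) n := by
  have hp : (q ^ 2) ^ N = 0 := by rw [pow_right_comm, hq, zero_pow two_ne_zero]
  rw [andrewsJ, andrewsH, andrewsH, mul_sum, mul_sum, ← sum_add_distrib]
  refine sum_congr rfl fun n _ => ?_
  -- The two H-terms combine into a multiple of 1 + q^(2n+1), exactly the factor missing from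
  -- `andrewsProd N q 0 n`, so the product no longer depends on n.
  have hB : (1 + q * q ^ (2 * n)) * andrewsProd N q 0 n = qTail N (-q) (q ^ 2) 0 := by
    rw [← prod_range_mul_qTail hp (n + 1), andrewsProd, prod_range_succ]
    simp only [zero_add, range_zero, prod_empty, one_mul]
    have : ∀ j, 1 - -q * (q ^ 2) ^ j = 1 + q ^ (2 * j + 1) := fun j => by ring
    simp only [this]
    ring
  rw [← hB, thetaTerm]
  have hc : n * (n - 1) = 2 * n.choose 2 := by
    rw [Nat.choose_two_right, Nat.mul_div_cancel' (Nat.even_mul_pred_self n).two_dvd]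
  rw [hc]
  ring

end Andrews

/-! ### Generating functions of sets of multisets -/

section MultisetGF

open PowerSeries

/-- The generating function counting by sum the multisets of positive integers in `A`. -/
noncomputable def multisetGF (A : Set (Multiset ℕ)) : PowerSeries ℤ :=
  PowerSeries.mk fun n => ({s | s ∈ A ∧ 0 ∉ s ∧ s.sum = n}.ncard : ℤ)

theorem finite_multiset_sum_eq (A : Set (Multiset ℕ)) (n : ℕ) :
    {s | s ∈ A ∧ 0 ∉ s ∧ s.sum = n}.Finite := by
  refine (Set.finite_range (fun P : n.Partition => P.parts)).subset ?_
  rintro s ⟨-, h0, hs⟩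
  exact ⟨⟨s, fun {i} hi => Nat.pos_of_ne_zero fun h => h0 (h ▸ hi), hs⟩, rfl⟩

theorem coeff_multisetGF_eq_card (A : Set (Multiset ℕ)) {n : ℕ} (Q : n.Partition → Prop)
    (h : ∀ P, Q P ↔ P.parts ∈ A) : coeff n (multisetGF A) = Nat.card {P // Q P} := by
  rw [multisetGF, coeff_mk, ← Nat.card_coe_set_eq]
  congr 1
  refine Nat.card_congr (Equiv.symm (Equiv.ofBijective (fun P => ⟨P.1.parts, (h _).1 P.2,
    fun h0 => (P.1.parts_pos h0).ne rfl, P.1.parts_sum⟩) ⟨?_, ?_⟩))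
  · intro P P' hP
    exact Subtype.ext (Nat.Partition.ext (congrArg Subtype.val hP))
  · rintro ⟨s, hA, h0, hs⟩
    exact ⟨⟨⟨s, fun {i} hi => Nat.pos_of_ne_zero fun h => h0 (h ▸ hi), hs⟩, (h _).2 hA⟩, rfl⟩

theorem multisetGF_union {A B : Set (Multiset ℕ)} (h : Disjoint A B) :
    multisetGF (A ∪ B) = multisetGF A + multisetGF B := by
  ext n
  simp only [multisetGF, map_add, coeff_mk]
  rw [← Nat.cast_add, ← Set.ncard_union_eq _ (finite_multiset_sum_eq A n)
    (finite_multiset_sum_eq B n)]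
  · congr 2
    ext s
    simp only [Set.mem_union, Set.mem_ofPred_eq]
    tauto
  · exact Set.disjoint_left.2 fun s hs hs' => Set.disjoint_left.1 h hs.1 hs'.1

theorem multisetGF_image_add (A : Set (Multiset ℕ)) {t : Multiset ℕ} (ht : 0 ∉ t) :
    multisetGF ((t + ·) '' A) = X ^ t.sum * multisetGF A := by
  ext n
  rw [coeff_X_pow_mul']
  simp only [multisetGF, coeff_mk]
  split_ifs with hn
  · congr 1
    rw [← Set.ncard_image_of_injective {s | s ∈ A ∧ 0 ∉ s ∧ s.sum = n - t.sum} (add_right_injective t)]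
    refine congrArg Set.ncard (Set.ext fun s' => ⟨?_, ?_⟩)
    · rintro ⟨⟨s, hs, rfl⟩, h0, rfl⟩
      refine ⟨s, ⟨hs, fun h => h0 (Multiset.mem_add.2 (Or.inr h)), ?_⟩, rfl⟩
      simp
    · rintro ⟨s, ⟨hs, h0, hn'⟩, rfl⟩
      refine ⟨⟨s, hs, rfl⟩, by simp [ht, h0], ?_⟩
      simp only [Multiset.sum_add]
      omega
  · rw [Nat.cast_eq_zero, Set.ncard_eq_zero (finite_multiset_sum_eq _ n)]
    refine Set.eq_empty_iff_forall_notMem.2 ?_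
    rintro _ ⟨⟨s, hs, rfl⟩, h0, rfl⟩
    simp at hn

theorem map_multisetGF_eq_one {R : Type*} [CommRing R] (φ : PowerSeries ℤ →+* R) {N : ℕ}
    (hq : φ X ^ N = 0) {A : Set (Multiset ℕ)} (h0 : 0 ∈ A) (h : ∀ s ∈ A, ∀ x ∈ s, N ≤ x) :
    φ (multisetGF A) = 1 := by
  have hd : X ^ N ∣ multisetGF A - 1 := by
    rw [X_pow_dvd_iff]
    intro n hn
    rw [map_sub, coeff_one, multisetGF, coeff_mk, sub_eq_zero]
    have key : ∀ s ∈ A, s.sum < N → s = 0 := by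
      intro s hs hlt
      by_contra hne
      obtain ⟨x, hx⟩ := Multiset.exists_mem_of_ne_zero hne
      exact absurd (h s hs x hx) (by have := Multiset.le_sum_of_mem hx; omega)
    split_ifs with hn0
    · rw [Nat.cast_eq_one, Set.ncard_eq_one]
      refine ⟨0, Set.eq_singleton_iff_unique_mem.2 ⟨⟨h0, by simp, by simp [hn0]⟩, ?_⟩⟩
      rintro s ⟨hs, -, hsum⟩
      exact key s hs (hsum ▸ hn)
    · rw [Nat.cast_eq_zero, Set.ncard_eq_zero (finite_multiset_sum_eq _ n)]
      refine Set.eq_empty_iff_forall_notMem.2 ?_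
      rintro s ⟨hs, -, hsum⟩
      rw [key s hs (hsum ▸ hn)] at hsum
      exact hn0 (by simpa using hsum.symm)
  obtain ⟨c, hc⟩ := hd
  rw [sub_eq_iff_eq_add.1 hc, map_add, map_mul, map_pow, hq, zero_mul, zero_add, map_one]

end MultisetGF

/-! ### Euler products over sets of exponents -/

section EulerProduct

variable {R : Type*} [CommRing R] {N : ℕ} {q : R}

/-- The product of `1 - q ^ x` over `x ∈ S`, for a nilpotent `q`. -/
noncomputable def eulerProd (q : R) (S : Set ℕ) : R := ∏ᶠ x ∈ S, (1 - q ^ x)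

theorem mulSupport_one_sub_pow (hq : q ^ N = 0) :
    Function.mulSupport (fun x : ℕ => 1 - q ^ x) ⊆ Set.Iio N := by
  intro x hx
  by_contra h
  exact hx (by simp [pow_eq_zero_of_le (not_lt.1 h) hq])

theorem eulerProd_union (hq : q ^ N = 0) {S T : Set ℕ} (h : Disjoint S T) :
    eulerProd q (S ∪ T) = eulerProd q S * eulerProd q T :=
  finprod_mem_union' h
    ((Set.finite_Iio N).subset fun _ hx => mulSupport_one_sub_pow hq hx.2)
    ((Set.finite_Iio N).subset fun _ hx => mulSupport_one_sub_pow hq hx.2)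

theorem eulerProd_insert (hq : q ^ N = 0) {S : Set ℕ} {a : ℕ} (h : a ∉ S) :
    eulerProd q (insert a S) = (1 - q ^ a) * eulerProd q S := by
  rw [Set.insert_eq, eulerProd_union hq (Set.disjoint_singleton_left.2 h), eulerProd,
    finprod_mem_singleton]

theorem eulerProd_eq_one (hq : q ^ N = 0) {S : Set ℕ} (h : ∀ x ∈ S, N ≤ x) : eulerProd q S = 1 :=
  finprod_mem_eq_one_of_forall_eq_one fun x hx => by simp [pow_eq_zero_of_le (h x hx) hq]

theorem qTail_eq_eulerProd (hq : q ^ N = 0) {b s : ℕ} (hs : s ≠ 0) :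
    qTail N (q ^ b) (q ^ s) 0 = eulerProd q (Set.range fun j => b + s * j) := by
  have hinj : Function.Injective fun j => b + s * j := fun i j h => by
    simpa [hs] using h
  rw [eulerProd, finprod_mem_range hinj, finprod_eq_prod_of_mulSupport_subset (s := range N)]
  · exact prod_congr rfl fun j _ => by ring
  · intro j hj
    have := @mulSupport_one_sub_pow _ _ _ _ hq (b + s * j) hj
    have h2 : j ≤ s * j := Nat.le_mul_of_pos_left j (Nat.pos_of_ne_zero hs)
    simp only [Set.mem_Iio] at this
    simp only [coe_range, Set.mem_Iio]
    omega

-- Descending induction on the lower bound M: either M is not a part, or one copy of it can be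
-- removed, so G_M = G_{M+1} + q^M G_M when M is allowed.
open PowerSeries in
theorem map_multisetGF_mul_eulerProd (φ : PowerSeries ℤ →+* R) (hq : φ X ^ N = 0) (p : ℕ → Prop)
    (d M : ℕ) (hM : 1 ≤ M) (hd : N ≤ M + d) :
    φ (multisetGF {s | ∀ x ∈ s, p x ∧ M ≤ x}) * eulerProd (φ X) {x | p x ∧ M ≤ x} = 1 := by
  induction d generalizing M with
  | zero =>
    rw [eulerProd_eq_one hq fun x hx => by have := hx.2; omega,
      map_multisetGF_eq_one φ hq (by simp) fun s hs x hx => by have := (hs x hx).2; omega, one_mul]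
  | succ d ih =>
    have ih := ih (M + 1) (by omega) (by omega)
    by_cases hp : p M
    · have h1 : {x | p x ∧ M ≤ x} = insert M {x | p x ∧ M + 1 ≤ x} := by
        ext x
        simp only [Set.mem_ofPred_eq, Set.mem_insert_iff]
        constructor
        · rintro ⟨hx, hxM⟩
          rcases hxM.eq_or_lt with h | h
          · exact Or.inl h.symm
          · exact Or.inr ⟨hx, h⟩
        · rintro (rfl | ⟨hx, h⟩)
          · exact ⟨hp, le_rfl⟩
          · exact ⟨hx, by omega⟩
      have h2 : {s : Multiset ℕ | ∀ x ∈ s, p x ∧ M ≤ x} = {s | ∀ x ∈ s, p x ∧ M + 1 ≤ x} ∪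
          (({M} : Multiset ℕ) + ·) '' {s | ∀ x ∈ s, p x ∧ M ≤ x} := by
        ext s
        constructor
        · intro hs
          by_cases hMs : M ∈ s
          · obtain ⟨t, rfl⟩ := Multiset.exists_cons_of_mem hMs
            exact Or.inr ⟨t, fun x hx => hs x (Multiset.mem_cons_of_mem hx), by simp⟩
          · refine Or.inl fun x hx => ⟨(hs x hx).1, ?_⟩
            have h1 := (hs x hx).2
            have h2 : x ≠ M := fun h => hMs (h ▸ hx)
            omega
        · rintro (hs | ⟨t, ht, rfl⟩) x hx
          · exact ⟨(hs x hx).1, by have := (hs x hx).2; omega⟩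
          · rcases Multiset.mem_add.1 hx with h | h
            · rw [Multiset.mem_singleton.1 h]; exact ⟨hp, le_rfl⟩
            · exact ht x h
      have h3 : φ (multisetGF {s | ∀ x ∈ s, p x ∧ M ≤ x}) =
          φ (multisetGF {s | ∀ x ∈ s, p x ∧ M + 1 ≤ x}) +
            φ X ^ M * φ (multisetGF {s | ∀ x ∈ s, p x ∧ M ≤ x}) := by
        conv_lhs => rw [h2]
        rw [multisetGF_union, multisetGF_image_add, map_add, map_mul, map_pow,
          Multiset.sum_singleton]
        · simp; omega
        · refine Set.disjoint_left.2 ?_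
          rintro _ hs ⟨t, _, rfl⟩
          have := (hs M (by simp)).2
          omega
      rw [h1, eulerProd_insert hq (by simp)]
      linear_combination ih + eulerProd (φ X) {x | p x ∧ M + 1 ≤ x} * h3
    · have h1 : ∀ x, p x ∧ M ≤ x ↔ p x ∧ M + 1 ≤ x := by
        intro x
        refine ⟨fun ⟨hx, hM⟩ => ⟨hx, ?_⟩, fun ⟨hx, hM⟩ => ⟨hx, by omega⟩⟩
        have : x ≠ M := fun h => hp (h ▸ hx)
        omega
      simp only [h1]
      exact ih

end EulerProduct

/-! ### Recurrence for the sum side -/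

section Windows

/-- The multisets with parts greater than `2 m`, no repeated odd part, at most `W` parts in each
window `{2 j, 2 j + 1, 2 j + 2}`, and at most `c` parts equal to `2 m + 1` or `2 m + 2`. -/
def windowSet (W c m : ℕ) : Set (Multiset ℕ) :=
  {s | (∀ x ≤ 2 * m, s.count x = 0) ∧ (∀ x, Odd x → s.count x ≤ 1) ∧
    (∀ j, s.count (2 * j) + s.count (2 * j + 1) + s.count (2 * j + 2) ≤ W) ∧
    s.count (2 * m + 1) + s.count (2 * m + 2) ≤ c}

theorem windowSet_zero (W m : ℕ) : windowSet W 0 m = windowSet W W (m + 1) := by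
  ext s
  constructor
  · rintro ⟨h1, h2, h3, h4⟩
    refine ⟨fun x hx => ?_, h2, h3, ?_⟩
    · rcases (by omega : x ≤ 2 * m ∨ x = 2 * m + 1 ∨ x = 2 * m + 2) with h | rfl | rfl
      · exact h1 x h
      · omega
      · omega
    · have := h3 (m + 1)
      rw [show 2 * (m + 1) = 2 * m + 2 by ring] at *
      omega
  · rintro ⟨h1, h2, h3, h4⟩
    refine ⟨fun x hx => h1 x (by omega), h2, h3, ?_⟩
    rw [h1 _ (by omega), h1 _ (by omega)]

/-- The window {2m+2, 2m+3, 2m+4} already holds c+1 parts, leaving room for d copies of 2m+3 and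
2m+4. -/
theorem image_add_windowSet_even (c d m : ℕ) :
    (Multiset.replicate (c + 1) (2 * m + 2) + ·) '' windowSet (c + 1 + d) d (m + 1) =
      {s | s ∈ windowSet (c + 1 + d) (c + 1) m ∧ s.count (2 * m + 1) = 0 ∧
        s.count (2 * m + 2) = c + 1} := by
  ext s
  constructor
  · rintro ⟨t, ⟨h1, h2, h3, h4⟩, rfl⟩
    have e1 := h1 (2 * m + 1) (by omega)
    have e2 := h1 (2 * m + 2) (by omega)
    have hc : ∀ x, (Multiset.replicate (c + 1) (2 * m + 2) + t).count x =
        (if 2 * m + 2 = x then c + 1 else 0) + t.count x := fun x => by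
      rw [Multiset.count_add, Multiset.count_replicate]
    simp only [windowSet, Set.mem_ofPred_eq, hc]
    refine ⟨⟨fun x hx => ?_, fun x hx => ?_, fun j => ?_, ?_⟩, ?_, ?_⟩
    · rw [h1 x (by omega), if_neg (by omega)]
    · rw [if_neg (by rintro rfl; rw [Nat.odd_iff] at hx; omega), zero_add]
      exact h2 x hx
    · have := h3 j
      rcases (by omega : j = m ∨ j = m + 1 ∨ (j ≠ m ∧ j ≠ m + 1)) with rfl | rfl | h
      · have := h1 (2 * j) (by omega)
        split_ifs <;> omega
      · rw [show 2 * (m + 1) = 2 * m + 2 by ring] at *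
        split_ifs <;> omega
      · split_ifs <;> omega
    · split_ifs <;> omega
    · split_ifs <;> omega
    · simp only [if_true]; omega
  · rintro ⟨⟨h1, h2, h3, h4⟩, h5, h6⟩
    have hc : ∀ x, (s.filter (2 * m + 2 < ·)).count x =
        if 2 * m + 2 < x then s.count x else 0 := fun x => Multiset.count_filter ..
    refine ⟨s.filter (2 * m + 2 < ·), ?_, ?_⟩
    · simp only [windowSet, Set.mem_ofPred_eq, hc]
      refine ⟨fun x hx => if_neg (by omega), fun x hx => ?_, fun j => ?_, ?_⟩
      · have := h2 x hx
        split_ifs <;> omega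
      · have := h3 j
        split_ifs <;> omega
      · have := h3 (m + 1)
        rw [show 2 * (m + 1) = 2 * m + 2 by ring] at *
        split_ifs <;> omega
    · ext x
      simp only [Multiset.count_add, Multiset.count_replicate, hc]
      rcases (by omega : x ≤ 2 * m ∨ x = 2 * m + 1 ∨ x = 2 * m + 2 ∨ 2 * m + 2 < x) with
        h | rfl | rfl | h
      · rw [h1 x h]; split_ifs <;> omega
      · split_ifs <;> omega
      · split_ifs <;> omega
      · split_ifs <;> omega

/-- The part 2m+1 lies outside the window {2m+2, 2m+3, 2m+4}, so one more place is left there than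
in the even case. -/
theorem image_add_windowSet_odd (c d m : ℕ) :
    (((2 * m + 1) ::ₘ Multiset.replicate c (2 * m + 2)) + ·) ''
        windowSet (c + 1 + d) (d + 1) (m + 1) =
      {s | s ∈ windowSet (c + 1 + d) (c + 1) m ∧ s.count (2 * m + 1) = 1 ∧
        s.count (2 * m + 2) = c} := by
  ext s
  constructor
  · rintro ⟨t, ⟨h1, h2, h3, h4⟩, rfl⟩
    have e1 := h1 (2 * m + 1) (by omega)
    have e2 := h1 (2 * m + 2) (by omega)
    have hc : ∀ x, ((2 * m + 1) ::ₘ Multiset.replicate c (2 * m + 2) + t).count x =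
        (if 2 * m + 2 = x then c else 0) + (if x = 2 * m + 1 then 1 else 0) + t.count x :=
      fun x => by rw [Multiset.count_add, Multiset.count_cons, Multiset.count_replicate]
    simp only [windowSet, Set.mem_ofPred_eq, hc]
    refine ⟨⟨fun x hx => ?_, fun x hx => ?_, fun j => ?_, ?_⟩, ?_, ?_⟩
    · rw [h1 x (by omega), if_neg (by omega), if_neg (by omega)]
    · have := h2 x hx
      rw [if_neg (by rintro rfl; rw [Nat.odd_iff] at hx; omega), zero_add]
      split_ifs with h
      · subst h; omega
      · omega
    · have := h3 j
      rcases (by omega : j = m ∨ j = m + 1 ∨ (j ≠ m ∧ j ≠ m + 1)) with rfl | rfl | h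
      · have := h1 (2 * j) (by omega)
        split_ifs <;> omega
      · rw [show 2 * (m + 1) = 2 * m + 2 by ring] at *
        split_ifs <;> omega
      · split_ifs <;> omega
    · split_ifs <;> omega
    · split_ifs <;> omega
    · split_ifs <;> omega
  · rintro ⟨⟨h1, h2, h3, h4⟩, h5, h6⟩
    have hc : ∀ x, (s.filter (2 * m + 2 < ·)).count x =
        if 2 * m + 2 < x then s.count x else 0 := fun x => Multiset.count_filter ..
    refine ⟨s.filter (2 * m + 2 < ·), ?_, ?_⟩
    · simp only [windowSet, Set.mem_ofPred_eq, hc]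
      refine ⟨fun x hx => if_neg (by omega), fun x hx => ?_, fun j => ?_, ?_⟩
      · have := h2 x hx
        split_ifs <;> omega
      · have := h3 j
        split_ifs <;> omega
      · have := h3 (m + 1)
        rw [show 2 * (m + 1) = 2 * m + 2 by ring] at *
        split_ifs <;> omega
    · ext x
      simp only [Multiset.count_add, Multiset.count_cons, Multiset.count_replicate, hc]
      rcases (by omega : x ≤ 2 * m ∨ x = 2 * m + 1 ∨ x = 2 * m + 2 ∨ 2 * m + 2 < x) with
        h | rfl | rfl | h
      · rw [h1 x h]; split_ifs <;> omega
      · split_ifs <;> omega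
      · split_ifs <;> omega
      · split_ifs <;> omega

open PowerSeries in
theorem multisetGF_windowSet_succ (c d m : ℕ) :
    multisetGF (windowSet (c + 1 + d) (c + 1) m) = multisetGF (windowSet (c + 1 + d) c m) +
      X ^ ((2 * m + 2) * (c + 1)) * multisetGF (windowSet (c + 1 + d) d (m + 1)) +
      X ^ (2 * m + 1 + (2 * m + 2) * c) * multisetGF (windowSet (c + 1 + d) (d + 1) (m + 1)) := by
  have hE := multisetGF_image_add (windowSet (c + 1 + d) d (m + 1))
    (t := Multiset.replicate (c + 1) (2 * m + 2)) (by simp [Multiset.mem_replicate])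
  have hO := multisetGF_image_add (windowSet (c + 1 + d) (d + 1) (m + 1))
    (t := (2 * m + 1) ::ₘ Multiset.replicate c (2 * m + 2)) (by simp [Multiset.mem_replicate])
  rw [image_add_windowSet_even, Multiset.sum_replicate, smul_eq_mul, mul_comm (c + 1)] at hE
  rw [image_add_windowSet_odd, Multiset.sum_cons, Multiset.sum_replicate, smul_eq_mul,
    mul_comm c] at hO
  rw [← hE, ← hO, ← multisetGF_union, ← multisetGF_union]
  · congr 1
    ext s
    simp only [Set.mem_union, Set.mem_ofPred_eq]
    constructor
    · intro hs
      obtain ⟨h1, h2, h3, h4⟩ := hs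
      have h5 := h2 (2 * m + 1) ⟨m, rfl⟩
      rcases (by omega : s.count (2 * m + 1) + s.count (2 * m + 2) ≤ c ∨
        (s.count (2 * m + 1) = 0 ∧ s.count (2 * m + 2) = c + 1) ∨
        (s.count (2 * m + 1) = 1 ∧ s.count (2 * m + 2) = c)) with h | h | h
      · exact Or.inl (Or.inl ⟨h1, h2, h3, h⟩)
      · exact Or.inl (Or.inr ⟨⟨h1, h2, h3, h4⟩, h⟩)
      · exact Or.inr ⟨⟨h1, h2, h3, h4⟩, h⟩
    · rintro ((⟨h1, h2, h3, h4⟩ | ⟨h, -⟩) | ⟨h, -⟩)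
      · exact ⟨h1, h2, h3, by omega⟩
      · exact h
      · exact h
  · refine Set.disjoint_left.2 ?_
    rintro s (⟨-, -, -, h⟩ | ⟨-, h, h'⟩) ⟨-, h5, h6⟩ <;> omega
  · refine Set.disjoint_left.2 ?_
    rintro s ⟨-, -, -, h⟩ ⟨-, h5, h6⟩
    omega

-- Recurrence and large-m value determine both sides: descending induction on m through e, with an
-- inner induction on c.
open PowerSeries in
theorem map_multisetGF_windowSet {R : Type*} [CommRing R] {N : ℕ} (φ : PowerSeries ℤ →+* R)
    (hq : φ X ^ N = 0) (e : ℕ) : ∀ (m : ℕ) (_ : N ≤ m + e) (c d : ℕ),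
    φ (multisetGF (windowSet (c + d) c m)) * qTail N 1 (φ X ^ 2) 1 = andrewsJ N (φ X) c d m := by
  induction e with
  | zero =>
    intro m hm c d
    rw [andrewsJ_eq_qTail hq c d m (by omega), map_multisetGF_eq_one φ hq, one_mul]
    · simp [windowSet]
    · intro s hs x hx
      by_contra h
      exact Multiset.count_ne_zero.2 hx (hs.1 x (by omega))
  | succ e ih =>
    intro m hm c
    have ih := ih (m + 1) (by omega)
    induction c with
    | zero =>
      intro d
      rw [windowSet_zero, andrewsJ_zero hq, ← ih d 0]
      simp
    | succ c ihc =>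
      intro d
      have h0 := ihc (d + 1)
      have h1 := ih d (c + 1)
      have h2 := ih (d + 1) c
      rw [show c + (d + 1) = c + 1 + d by ring] at h0
      rw [show d + (c + 1) = c + 1 + d by ring] at h1
      rw [show d + 1 + c = c + 1 + d by ring] at h2
      rw [andrewsJ_succ hq, ← h0, ← h1, ← h2, multisetGF_windowSet_succ]
      simp only [map_add, map_mul, map_pow]
      ring

end Windows

/-! ### From difference conditions to window conditions -/

theorem List.lt_countP_iff_of_pairwise_ge {l : List ℕ} (hl : l.Pairwise (· ≥ ·)) (a p : ℕ)
    (hp : p < l.length) : p < l.countP (a < ·) ↔ a < l[p] := by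
  induction l generalizing p with
  | nil => simp at hp
  | cons b l ih =>
    rw [List.pairwise_cons] at hl
    rcases p with _ | p
    · by_cases h : a < b
      · simp [h]
      · have : l.countP (a < ·) = 0 := by
          rw [List.countP_eq_zero]
          intro x hx
          have := hl.1 x hx
          simp; omega
        simp only [List.countP_cons, this, h]
        simp [h]
    · have ih := ih hl.2 p (by simpa using hp)
      simp only [List.getElem_cons_succ]
      by_cases h : a < b
      · simp only [List.countP_cons, h]
        simpa using ih
      · rw [← ih]
        have : l.countP (a < ·) = 0 := by
          rw [List.countP_eq_zero]
          intro x hx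
          have := hl.1 x hx
          simp; omega
        simp [this, h]

theorem List.countP_lt_eq_add_count (l : List ℕ) (a : ℕ) :
    l.countP (a < ·) = l.countP (a + 1 < ·) + l.count (a + 1) := by
  induction l with
  | nil => simp
  | cons b l ih =>
    simp only [List.countP_cons, List.count_cons, ih, decide_eq_true_eq, beq_iff_eq]
    split_ifs <;> omega

theorem isGGASumPartition_iff {k i n : ℕ} (hk : 1 ≤ k) (hi : 1 ≤ i) (P : n.Partition) :
    IsGGASumPartition k i P ↔ P.parts ∈ windowSet (k - 1) (k - i) 0 := by
  set l := partsList P with hl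
  have hsort : l.Pairwise (· ≥ ·) := Multiset.pairwise_sort P.parts (· ≥ ·)
  have hc : ∀ x, P.parts.count x = l.count x := fun x => by
    rw [← Multiset.coe_count, hl, partsList, Multiset.sort_eq]
  have h0 : l.count 0 = 0 := by
    rw [← hc, Multiset.count_eq_zero]
    exact fun h => (P.parts_pos h).ne rfl
  have hlen : ∀ a, l.countP (a < ·) ≤ l.length := fun a => List.countP_le_length
  have hstep := List.countP_lt_eq_add_count l
  have hlt := fun a p hp => List.lt_countP_iff_of_pairwise_ge hsort a p hp
  simp only [IsGGASumPartition, windowSet, Set.mem_ofPred_eq, hc, ← hl]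
  constructor
  · rintro ⟨h1, h2, h3⟩
    refine ⟨fun x hx => by rwa [Nat.le_zero.1 hx], h1, fun j => ?_, h3⟩
    -- The window {0, 1, 2} is controlled by condition (3), as k-i ≤ k-1.
    rcases j with _ | j
    · simp only [mul_zero, zero_add]; omega
    · by_contra! hj
      have e1 := hstep (2 * j + 1)
      have e2 := hstep (2 * j + 2)
      have e3 := hstep (2 * j + 3)
      rw [show 2 * (j + 1) = 2 * j + 2 by ring] at hj
      simp only [add_assoc, Nat.reduceAdd] at e1 e2 e3 hj
      -- Zero-based index of the largest part in the overfull window {2j+2, 2j+3, 2j+4}; the entry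
      -- k-1 places later is still in the window, which contradicts (2) for either parity.
      set p := l.countP (2 * j + 4 < ·) with hp
      have hpk : p + (k - 1) < l.countP (2 * j + 1 < ·) := by simp only [hp]; omega
      have hpk' := hpk.trans_le (hlen _)
      have g1 := (hlt _ _ hpk').1 hpk
      have g2 := (hlt (2 * j + 4) p (by omega)).not.1 (by omega)
      have g3 := (hlt (2 * j + 1) p (by omega)).1 (by omega)
      have := h2 p hpk'
      rcases Nat.even_or_odd l[p] with he | ho
      · have := this.2 he
        omega
      · have := this.1 ho
        rw [Nat.odd_iff] at ho
        omega
  · rintro ⟨h1, h2, h3, h4⟩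
    refine ⟨h2, fun p hp => ⟨fun ho => ?_, fun he => ?_⟩, h4⟩
    · by_contra hlt'
      obtain ⟨j, hj⟩ := ho
      rcases j with _ | j
      · have : l[p + (k - 1)] ≠ 0 := fun h => by
          have := List.count_pos_iff.2 (h ▸ List.getElem_mem hp)
          omega
        have g2 := (hlt 0 _ hp).2 (by omega)
        have g3 := (hlt 1 p (by omega)).not.2 (by omega)
        have e1 := hstep 0
        have := h3 0
        simp only [mul_zero, zero_add] at *
        omega
      · have g2 := (hlt (2 * j + 1) _ hp).2 (by omega)
        have g3 := (hlt (2 * j + 3) p (by omega)).not.2 (by omega)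
        have e1 := hstep (2 * j + 1)
        have e2 := hstep (2 * j + 2)
        have := h3 (j + 1)
        rw [show 2 * (j + 1) = 2 * j + 2 by ring] at this
        simp only [add_assoc, Nat.reduceAdd] at *
        omega
    · by_contra hlt'
      obtain ⟨j, hj⟩ := he
      have hne : ∀ r (hr : r < l.length), l[r] ≠ 0 := fun r hr h => by
        have := List.count_pos_iff.2 (h ▸ List.getElem_mem hr)
        omega
      have := hne p (by omega)
      have := hne _ hp
      obtain ⟨j, rfl⟩ : ∃ j', j = j' + 1 := ⟨j - 1, by omega⟩
      rcases j with _ | j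
      · have g2 := (hlt 0 _ hp).2 (by omega)
        have g3 := (hlt 2 p (by omega)).not.2 (by omega)
        have e1 := hstep 0
        have e2 := hstep 1
        have := h3 0
        simp only [mul_zero, zero_add, Nat.reduceAdd] at *
        omega
      · have g2 := (hlt (2 * j + 1) _ hp).2 (by omega)
        have g3 := (hlt (2 * j + 4) p (by omega)).not.2 (by omega)
        have e1 := hstep (2 * j + 1)
        have e2 := hstep (2 * j + 2)
        have e3 := hstep (2 * j + 3)
        have := h3 (j + 1)
        rw [show 2 * (j + 1) = 2 * j + 2 by ring] at this
        simp only [add_assoc, Nat.reduceAdd] at *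
        omega

/-! ### The product side and the conclusion -/

/-- The parts allowed in the product side: positive integers that are not `2` modulo `4` and not
`0`, `b` or `-b` modulo `4 k`, for odd `b = 2 k - 2 i + 1`. -/
def IsAllowedPart (k b x : ℕ) : Prop :=
  x % 4 ≠ 2 ∧ x % (4 * k) ≠ 0 ∧ x % (4 * k) ≠ b ∧ x % (4 * k) ≠ 4 * k - b

theorem isGGAProductPartition_iff {k i n : ℕ} (hi : 1 ≤ i) (hik : i ≤ k) (P : n.Partition) :
    IsGGAProductPartition k i P ↔
      P.parts ∈ {s : Multiset ℕ | ∀ x ∈ s, IsAllowedPart k (2 * (k - i) + 1) x ∧ 1 ≤ x} := by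
  have hmod : ∀ x r : ℕ, r < 4 * k → (((x : ℤ) ≡ (r : ℤ) [ZMOD 4 * (k : ℤ)]) ↔ x % (4 * k) = r) := by
    intro x r hr
    rw [show (4 : ℤ) * (k : ℤ) = ((4 * k : ℕ) : ℤ) by push_cast; rfl, Int.natCast_modEq_iff,
      Nat.ModEq, Nat.mod_eq_of_lt hr]
  refine forall₂_congr fun x hx => ?_
  have h1 := hmod x 0 (by omega)
  have h2 := hmod x (2 * (k - i) + 1) (by omega)
  have h3 := hmod x (4 * k - (2 * (k - i) + 1)) (by omega)
  have h4 : (x : ℤ) ≡ 2 [ZMOD 4] ↔ x % 4 = 2 := by rw [Int.ModEq]; omega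
  rw [show ((4 * k - (2 * (k - i) + 1) : ℕ) : ℤ) = 2 * (k : ℤ) + (2 * (i : ℤ) - 1) by omega] at h3
  rw [show ((2 * (k - i) + 1 : ℕ) : ℤ) = 2 * (k : ℤ) - (2 * (i : ℤ) - 1) by omega] at h2
  rw [Nat.cast_zero] at h1
  rw [h1, h2, h3, h4, IsAllowedPart]
  have := P.parts_pos hx
  tauto

section

variable {R : Type*} [CommRing R] {N : ℕ} {q : R}

theorem range_add_mul_eq {b s : ℕ} (hb : b < s) :
    (Set.range fun j => b + s * j) = {x | x % s = b} := by
  ext x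
  constructor
  · rintro ⟨j, rfl⟩
    simp [Nat.mod_eq_of_lt hb]
  · rintro rfl
    exact ⟨x / s, Nat.mod_add_div x s⟩

theorem range_self_add_mul_eq (s : ℕ) (hs : s ≠ 0) :
    (Set.range fun j => s + s * j) = {x | x % s = 0 ∧ 1 ≤ x} := by
  ext x
  constructor
  · rintro ⟨j, rfl⟩
    exact ⟨by simp, Nat.le_add_right_of_le (Nat.pos_of_ne_zero hs)⟩
  · rintro ⟨h, hx⟩
    obtain ⟨j, rfl⟩ := Nat.dvd_of_mod_eq_zero h
    rcases j with _ | j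
    · simp at hx
    · exact ⟨j, by ring⟩

theorem qTail_one_one (N : ℕ) (p : R) : qTail N 1 p 1 = qTail N p p 0 :=
  prod_congr rfl fun j _ => by ring

theorem qTail_neg_mul_qTail (N : ℕ) (q : R) :
    qTail N (-q) (q ^ 2) 0 * qTail N q (q ^ 2) 0 = qTail N (q ^ 2) (q ^ 4) 0 := by
  rw [qTail, qTail, qTail, ← prod_mul_distrib]
  exact prod_congr rfl fun j _ => by ring

/-- Uses (-q;q²)_∞ (q;q²)_∞ = (q²;q⁴)_∞ and (q²;q⁴)_∞ (q⁴;q⁴)_∞ = (q²;q²)_∞. -/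
theorem qTail_neg_mul_eulerProd (hq : q ^ N = 0) :
    qTail N (-q) (q ^ 2) 0 * eulerProd q {x | x % 4 ≠ 2 ∧ 1 ≤ x} = qTail N 1 (q ^ 2) 1 := by
  have h1 : {x | x % 4 ≠ 2 ∧ 1 ≤ x} = {x | x % 2 = 1} ∪ {x | x % 4 = 0 ∧ 1 ≤ x} := by
    ext x; simp only [Set.mem_union, Set.mem_ofPred_eq]; omega
  have h2 : {x | x % 2 = 0 ∧ 1 ≤ x} = {x | x % 4 = 2} ∪ {x | x % 4 = 0 ∧ 1 ≤ x} := by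
    ext x; simp only [Set.mem_union, Set.mem_ofPred_eq]; omega
  have e1 := qTail_eq_eulerProd (b := 1) hq two_ne_zero
  have e2 := qTail_eq_eulerProd (b := 2) hq four_ne_zero
  have e3 := qTail_eq_eulerProd (b := 2) hq two_ne_zero
  rw [range_add_mul_eq (by norm_num), pow_one] at e1
  rw [range_add_mul_eq (by norm_num)] at e2
  rw [range_self_add_mul_eq _ two_ne_zero] at e3
  rw [qTail_one_one, e3, h1, h2, eulerProd_union hq, eulerProd_union hq, ← e1, ← e2, ← mul_assoc,
    qTail_neg_mul_qTail]
  · exact Set.disjoint_left.2 fun x (hx : _ = _) hx' => by have := hx'.1; omega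
  · exact Set.disjoint_left.2 fun x (hx : _ = _) hx' => by have := hx'.1; omega

theorem qTail_mul_eulerProd_allowed (hq : q ^ N = 0) {k b : ℕ} (hb : Odd b) (hbk : b < 2 * k) :
    (qTail N (q ^ b) (q ^ (4 * k)) 0 * qTail N (q ^ (4 * k - b)) (q ^ (4 * k)) 0 *
      qTail N 1 (q ^ (4 * k)) 1) * eulerProd q {x | IsAllowedPart k b x ∧ 1 ≤ x} =
        eulerProd q {x | x % 4 ≠ 2 ∧ 1 ≤ x} := by
  have hk : 4 * k ≠ 0 := by omega
  have hb1 : 1 ≤ b := hb.pos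
  rw [qTail_one_one, qTail_eq_eulerProd hq hk, qTail_eq_eulerProd hq hk, qTail_eq_eulerProd hq hk,
    range_add_mul_eq (by omega), range_add_mul_eq (by omega), range_self_add_mul_eq _ hk,
    ← eulerProd_union hq, ← eulerProd_union hq, ← eulerProd_union hq]
  · congr 1
    ext x
    -- Residues mod 4k determine residues mod 4; as b is odd, the classes 0 and ±b never meet 2 mod
    -- 4.
    have h4 : x % (4 * k) % 4 = x % 4 := Nat.mod_mul_right_mod x 4 k
    rw [Nat.odd_iff] at hb
    have h0 : x < 1 → x % (4 * k) = 0 := fun h => by rw [Nat.lt_one_iff.1 h, Nat.zero_mod]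
    simp only [Set.mem_union, Set.mem_ofPred_eq, IsAllowedPart]
    omega
  · refine Set.disjoint_left.2 ?_
    rintro x ((hx | hx) | ⟨hx, -⟩) ⟨⟨-, h1, h2, h3⟩, -⟩
    exacts [h2 hx, h3 hx, h1 hx]
  · refine Set.disjoint_left.2 ?_
    rintro x (hx | hx) ⟨h, -⟩ <;> simp only [Set.mem_ofPred_eq] at hx <;> omega
  · refine Set.disjoint_left.2 fun x hx hx' => ?_
    simp only [Set.mem_ofPred_eq] at hx hx'
    omega

open PowerSeries in
theorem map_multisetGF_windowSet_eq (φ : PowerSeries ℤ →+* R) (hq : φ X ^ N = 0) (c d : ℕ) :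
    φ (multisetGF (windowSet (c + d) c 0)) =
      φ (multisetGF {s | ∀ x ∈ s, IsAllowedPart (c + d + 1) (2 * c + 1) x ∧ 1 ≤ x}) := by
  set q := φ X
  have hp : (q ^ 2) ^ N = 0 := by rw [pow_right_comm, hq, zero_pow two_ne_zero]
  have hF := map_multisetGF_windowSet φ hq N 0 (by omega) c d
  have hG := map_multisetGF_mul_eulerProd φ hq (IsAllowedPart (c + d + 1) (2 * c + 1)) N 1 le_rfl
    (by omega)
  rw [andrewsJ_at_zero hq, sum_thetaTerm (by rw [pow_right_comm, hq, zero_pow (by omega)]),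
    ← pow_add, show 2 * c + 4 * d + 3 + (2 * c + 1) = 4 * (c + d + 1) by ring,
    show 2 * c + 4 * d + 3 = 4 * (c + d + 1) - (2 * c + 1) by omega] at hF
  have h1 := qTail_mul_eulerProd_allowed hq (k := c + d + 1) (odd_two_mul_add_one c) (by omega)
  have h2 := qTail_neg_mul_eulerProd hq
  have hu : IsUnit (qTail N 1 (q ^ 2) 1) := by
    rw [qTail, IsUnit.prod_iff]
    exact fun j _ => by rw [one_mul]; exact isUnit_one_sub_pow hp (by omega)
  apply hu.mul_right_cancel
  set G := φ (multisetGF {s | ∀ x ∈ s, IsAllowedPart (c + d + 1) (2 * c + 1) x ∧ 1 ≤ x})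
  rw [hF, ← h2, ← h1]
  linear_combination (-qTail N (-q) (q ^ 2) 0 * (qTail N (q ^ (2 * c + 1)) (q ^ (4 * (c + d + 1))) 0 *
    qTail N (q ^ (4 * (c + d + 1) - (2 * c + 1))) (q ^ (4 * (c + d + 1))) 0 *
      qTail N 1 (q ^ (4 * (c + d + 1))) 1)) * hG

end

open PowerSeries in
theorem multisetGF_windowSet_eq (c d : ℕ) :
    multisetGF (windowSet (c + d) c 0) =
      multisetGF {s | ∀ x ∈ s, IsAllowedPart (c + d + 1) (2 * c + 1) x ∧ 1 ≤ x} := by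
  ext n
  -- Reduction modulo X^(n+1) preserves the coefficient of X^n and makes X nilpotent.
  have h := map_multisetGF_windowSet_eq
    (Ideal.Quotient.mk (Ideal.span {(X : PowerSeries ℤ) ^ (n + 1)})) (N := n + 1)
    (by rw [← map_pow, Ideal.Quotient.eq_zero_iff_mem]; exact Ideal.mem_span_singleton_self _) c d
  rw [Ideal.Quotient.eq, Ideal.mem_span_singleton, X_pow_dvd_iff] at h
  exact sub_eq_zero.1 (by simpa using h n (Nat.lt_succ_self n))

theorem mainTheorem1 (k i : ℕ) (hk : 1 ≤ k) (hi : 1 ≤ i) (hik : i ≤ k) (n : ℕ) :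
    Nat.card {P : n.Partition // IsGGAProductPartition k i P} =
      Nat.card {P : n.Partition // IsGGASumPartition k i P} := by
  have h := congrArg (PowerSeries.coeff n) (multisetGF_windowSet_eq (k - i) (i - 1))
  rw [show k - i + (i - 1) = k - 1 by omega, show k - 1 + 1 = k by omega,
    coeff_multisetGF_eq_card _ _ (isGGASumPartition_iff hk hi),
    coeff_multisetGF_eq_card _ _ (isGGAProductPartition_iff hi hik)] at h
  exact_mod_cast h.symm
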